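/- Let $n\ge 1$ and let $D^n=\{x\in\mathbb{R}^n:\|x\|\le 1\}$ be the closed Euclidean unit ball. A ReLU network from $\mathbb{R}^n$ to $\mathbb{R}$ is given by affine maps $A_i:\mathbb{R}^{n_i}\to\mathbb{R}^{n_{i+1}}$, $A_i(x)=W_ix+b_i$, $i=1,\dots,k$, with $k\ge 1$, $n_1=n$ and $n_{k+1}=1$. Its depth is $k$, its width is $\max\{n_i: 1\le i\le k\}$, and it computes the function $$\mathrm{ReLU}\circ A_k\circ \mathrm{ReLU}\circ A_{k-1}\circ\cdots\circ \mathrm{ReLU}\circ A_1$$ (ReLU output) or $$A_k\circ \mathrm{ReLU}\circ A_{k-1}\circ\cdots\circ \mathrm{ReLU}\circ A_1$$ (affine output), where $\mathrm{ReLU}(x)=\max\{0,x\}$ is applied to each coordinate. For every $\delta>0$ there is a continuous function $f:D^n\to\mathbb{R}$ such that for every ReLU network of width at most $n$ and of arbitrary depth, each of the two functions $\mathrm{Net}$ that it computes (with ReLU output and with affine output) satisfies $$|\mathrm{Net}(x)-f(x)|\ge\delta\quad\text{for some } x\in D^n.$$ -/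

import Mathlib

/-- The scalar rectified linear unit `max 0 x`, applied to every coordinate of a vector. -/
def reluVec {d : ℕ} (x : Fin d → ℝ) : Fin d → ℝ := fun i => max 0 (x i)

/-- The affine map `x ↦ W x + b`. -/
def affineLayer {p q : ℕ} (W : Matrix (Fin q) (Fin p) ℝ) (b : Fin q → ℝ) (x : Fin p → ℝ) :
    Fin q → ℝ :=
  W.mulVec x + b

/-- The parameters of a fully connected network with input dimension `n` and output dimension `m`:
a nonempty list of affine layers `A₁ : ℝ^{n₁} → ℝ^{n₂}, …, A_k : ℝ^{n_k} → ℝ^{n_{k+1}}` of matching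
dimensions, with `n₁ = n` and `n_{k+1} = m`. The depth `k ≥ 1` and the dimensions
`n₂, …, n_k` are arbitrary. -/
inductive DNN : ℕ → ℕ → Type
  /-- A network that consists of a single layer. -/
  | last {p m : ℕ} (W : Matrix (Fin m) (Fin p) ℝ) (b : Fin m → ℝ) : DNN p m
  /-- The layer given by `W` and `b`, followed by the network `N`. -/
  | cons {p q m : ℕ} (W : Matrix (Fin q) (Fin p) ℝ) (b : Fin q → ℝ) (N : DNN q m) : DNN p m

namespace DNN

/-- The depth `k`: the number of layers. -/
def depth : {n m : ℕ} → DNN n m → ℕ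
  | _, _, last _ _ => 1
  | _, _, cons _ _ N => N.depth + 1

/-- The width `max {n_i : i = 1, …, k}`: the largest dimension of the input of a layer. -/
def width : {n m : ℕ} → DNN n m → ℕ
  | n, _, last _ _ => n
  | n, _, cons _ _ N => max n N.width

/-- The map `ReLU ∘ A_k ∘ ReLU ∘ A_{k-1} ∘ ⋯ ∘ ReLU ∘ A₁`, with ReLU on every layer,
the output layer included. -/
def reluOutput : {n m : ℕ} → DNN n m → (Fin n → ℝ) → (Fin m → ℝ)
  | _, _, last W b, x => reluVec (affineLayer W b x)
  | _, _, cons W b N, x => N.reluOutput (reluVec (affineLayer W b x))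

/-- The map `A_k ∘ ReLU ∘ A_{k-1} ∘ ⋯ ∘ ReLU ∘ A₁`, with ReLU on every hidden layer and an affine
output layer. -/
def affineOutput : {n m : ℕ} → DNN n m → (Fin n → ℝ) → (Fin m → ℝ)
  | _, _, last W b, x => affineLayer W b x
  | _, _, cons W b N, x => N.affineOutput (reluVec (affineLayer W b x))

end DNN

/-! A network of width at most `n` obeys a maximum principle: on any compact `K`, each value is
matched or exceeded on `frontier K`. So it cannot follow a cone that is `2 * δ` at the centre of the
ball and `0` on the sphere. The principle is proved by induction on layers. A singular layer is
constant along a line, which leads to the frontier. An invertible layer is a homeomorphism, so only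
ReLU remains (`reluVec_le_frontier`). Arbitrary compact sets are needed because `K` is replaced by
its image under a layer and cut with the orthant. -/

/-- A ray that starts in a compact set meets its frontier. -/
theorem IsCompact.exists_add_smul_mem_frontier {E : Type*} [NormedAddCommGroup E]
    [NormedSpace ℝ E] {K : Set E} (hK : IsCompact K) {x v : E} (hx : x ∈ K) (hv : v ≠ 0) :
    ∃ t : ℝ, 0 ≤ t ∧ x + t • v ∈ frontier K := by
  obtain ⟨R, hR⟩ := hK.isBounded.exists_norm_le
  have hv' : 0 < ‖v‖ := norm_pos_iff.2 hv
  have hR0 : 0 ≤ R := (norm_nonneg x).trans (hR x hx)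
  have hpre : IsPreconnected ((fun t : ℝ => x + t • v) '' Set.Ici 0) :=
    isPreconnected_Ici.image _ (by fun_prop)
  -- A displacement of length `2 * R + 1` exceeds the distance `2 * R` possible between points of
  -- `K`.
  have hout : x + ((2 * R + 1) / ‖v‖) • v ∉ K := by
    intro h
    have h1 := hR _ h
    have h2 : ‖((2 * R + 1) / ‖v‖) • v‖ = 2 * R + 1 := by
      rw [norm_smul, Real.norm_of_nonneg (by positivity), div_mul_cancel₀ _ hv'.ne']
    have h3 := norm_sub_le (x + ((2 * R + 1) / ‖v‖) • v) x
    rw [add_sub_cancel_left, h2] at h3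
    linarith [hR x hx]
  by_contra! hcon
  have hin : ∀ t : ℝ, 0 ≤ t → x + t • v ∈ K → x + t • v ∈ interior K := fun t ht h => by
    by_contra hi
    exact hcon t ht ⟨subset_closure h, hi⟩
  have hsub := hpre.subset_left_of_subset_union isOpen_interior hK.isClosed.isOpen_compl
    (disjoint_compl_right.mono_left interior_subset)
    (by
      rintro _ ⟨t, ht, rfl⟩
      by_cases h : x + t • v ∈ K
      · exact Or.inl (hin t ht h)
      · exact Or.inr h)
    ⟨x + (0 : ℝ) • v, Set.mem_image_of_mem (fun t : ℝ => x + t • v) (Set.mem_Ici.2 le_rfl),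
      hin 0 le_rfl (by simpa using hx)⟩
  exact hout (interior_subset (hsub (Set.mem_image_of_mem (fun t : ℝ => x + t • v)
    (Set.mem_Ici.2 (show 0 ≤ (2 * R + 1) / ‖v‖ by positivity)))))

theorem affineLayer_add_smul {p q : ℕ} (W : Matrix (Fin q) (Fin p) ℝ) (b : Fin q → ℝ)
    (x v : Fin p → ℝ) (t : ℝ) :
    affineLayer W b (x + t • v) = affineLayer W b x + t • W.mulVec v := by
  simp only [affineLayer, Matrix.mulVec_add, Matrix.mulVec_smul]
  abel

/-- Each coordinate of an affine map on a nontrivial space attains on the frontier of a compact set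
a value at least as large as any given value on the set. -/
theorem affineLayer_le_frontier {p q : ℕ} (hp : 1 ≤ p) (W : Matrix (Fin q) (Fin p) ℝ)
    (b : Fin q → ℝ) (j : Fin q) {K : Set (Fin p → ℝ)} (hK : IsCompact K) {x : Fin p → ℝ}
    (hx : x ∈ K) : ∃ y ∈ frontier K, affineLayer W b x j ≤ affineLayer W b y j := by
  obtain ⟨v, hv, hpos⟩ : ∃ v : Fin p → ℝ, v ≠ 0 ∧ 0 ≤ W.mulVec v j := by
    have h1 : (1 : Fin p → ℝ) ≠ 0 := fun h => by simpa using congrFun h ⟨0, hp⟩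
    rcases le_total 0 (W.mulVec 1 j) with h | h
    · exact ⟨1, h1, h⟩
    · exact ⟨-1, neg_ne_zero.2 h1, by simpa [Matrix.mulVec_neg] using h⟩
  obtain ⟨t, ht, hy⟩ := hK.exists_add_smul_mem_frontier hx hv
  refine ⟨_, hy, ?_⟩
  rw [affineLayer_add_smul]
  simpa using mul_nonneg ht hpos

/-- If `g` satisfies the maximum principle on all compact sets, then so does `g ∘ ReLU`. -/
theorem reluVec_le_frontier {p : ℕ} (g : (Fin p → ℝ) → ℝ)
    (hg : ∀ K : Set (Fin p → ℝ), IsCompact K → ∀ x ∈ K, ∃ y ∈ frontier K, g x ≤ g y)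
    {K : Set (Fin p → ℝ)} (hK : IsCompact K) {x : Fin p → ℝ} (hx : x ∈ K) :
    ∃ y ∈ frontier K, g (reluVec x) ≤ g (reluVec y) := by
  -- Decreasing a nonpositive coordinate does not change `reluVec`.
  have ray : ∀ z ∈ K, (∃ i, z i ≤ 0) → ∃ y ∈ frontier K, reluVec y = reluVec z := by
    rintro z hz ⟨i, hi⟩
    obtain ⟨t, ht, hy⟩ := hK.exists_add_smul_mem_frontier hz
      (v := -Pi.single i 1) (neg_ne_zero.2 (by simp))
    refine ⟨_, hy, funext fun k => ?_⟩
    by_cases hk : k = i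
    · subst hk
      simp only [reluVec, Pi.add_apply, Pi.smul_apply, Pi.neg_apply, Pi.single_eq_same, smul_eq_mul]
      rw [max_eq_left hi, max_eq_left (by linarith)]
    · simp [reluVec, hk]
  have relu_of_nonneg : ∀ z : Fin p → ℝ, 0 ≤ z → reluVec z = z := fun z hz =>
    funext fun i => max_eq_right (hz i)
  by_cases hx0 : ∃ i, x i ≤ 0
  · obtain ⟨y, hy, hxy⟩ := ray x hx hx0
    exact ⟨y, hy, by rw [hxy]⟩
  · push Not at hx0
    have hx1 : 0 ≤ x := fun i => (hx0 i).le
    -- ReLU is the identity on the orthant. A frontier point of the intersection either has a zero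
    -- coordinate, so that `ray` applies, or is interior to the orthant and hence in `frontier K`.
    obtain ⟨y, hy, hxy⟩ := hg (K ∩ Set.Ici 0) (hK.inter_right isClosed_Ici) x ⟨hx, hx1⟩
    have hyK : y ∈ K ∩ Set.Ici 0 := (hK.inter_right isClosed_Ici).isClosed.frontier_subset hy
    rw [relu_of_nonneg x hx1]
    by_cases hy0 : ∃ i, y i ≤ 0
    · obtain ⟨z, hz, hzy⟩ := ray y hyK.1 hy0
      exact ⟨z, hz, by rwa [hzy, relu_of_nonneg y hyK.2]⟩
    · push Not at hy0
      refine ⟨y, ?_, by rwa [relu_of_nonneg y hyK.2]⟩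
      have hint : y ∈ interior (Set.Ici (0 : Fin p → ℝ)) := by
        have hopen : IsOpen {z : Fin p → ℝ | ∀ i, 0 < z i} := by
          simp only [Set.ofPred_forall]
          exact isOpen_iInter_of_finite fun i => isOpen_lt continuous_const (continuous_apply i)
        exact interior_maximal (fun z hz i => (hz i).le) hopen hy0
      refine ⟨subset_closure hyK.1, fun h => hy.2 ?_⟩
      rw [interior_inter]
      exact ⟨h, hint⟩

/-- Precomposition with a layer whose output dimension does not exceed its input dimension preserves
the maximum principle. -/
theorem reluVec_affineLayer_le_frontier {p q : ℕ} (hp : 1 ≤ p) (hqp : q ≤ p)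
    (W : Matrix (Fin q) (Fin p) ℝ) (b : Fin q → ℝ) (g : (Fin q → ℝ) → ℝ)
    (hg : q = p → ∀ K : Set (Fin q → ℝ), IsCompact K → ∀ x ∈ K, ∃ y ∈ frontier K, g x ≤ g y)
    {K : Set (Fin p → ℝ)} (hK : IsCompact K) {x : Fin p → ℝ} (hx : x ∈ K) :
    ∃ y ∈ frontier K, g (reluVec (affineLayer W b x)) ≤ g (reluVec (affineLayer W b y)) := by
  by_cases hinj : Function.Injective W.mulVecLin
  · have hpq : q = p := by
      refine le_antisymm hqp ?_
      simpa using LinearMap.finrank_le_finrank_of_injective hinj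
    subst hpq
    let h : (Fin q → ℝ) ≃ₜ (Fin q → ℝ) :=
      (LinearEquiv.ofInjectiveEndo W.mulVecLin hinj).toContinuousLinearEquiv.toHomeomorph.trans
        (Homeomorph.addRight b)
    have hh : ∀ z, h z = affineLayer W b z := fun z => rfl
    obtain ⟨_, hy, hxy⟩ := reluVec_le_frontier g (hg rfl) (hK.image h.continuous)
      (Set.mem_image_of_mem h hx)
    rw [← h.image_frontier] at hy
    obtain ⟨y, hy, rfl⟩ := hy
    exact ⟨y, hy, by simpa only [hh] using hxy⟩
  · obtain ⟨v, hv, hv0⟩ : ∃ v, W.mulVec v = 0 ∧ v ≠ 0 := by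
      rw [injective_iff_map_eq_zero] at hinj
      push Not at hinj
      exact hinj
    obtain ⟨t, -, hy⟩ := hK.exists_add_smul_mem_frontier hx hv0
    exact ⟨_, hy, by rw [affineLayer_add_smul, hv, smul_zero, add_zero]⟩

namespace DNN

theorem le_width {n m : ℕ} (N : DNN n m) : n ≤ N.width := by
  cases N <;> simp [width]

/-- Maximum principle for networks whose width is at most the input dimension, with affine
output. -/
theorem affineOutput_le_frontier {n m : ℕ} (N : DNN n m) (hn : 1 ≤ n) (hN : N.width ≤ n)
    (j : Fin m) (K : Set (Fin n → ℝ)) (hK : IsCompact K) (x : Fin n → ℝ) (hx : x ∈ K) :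
    ∃ y ∈ frontier K, N.affineOutput x j ≤ N.affineOutput y j := by
  induction N with
  | last W b => exact affineLayer_le_frontier hn W b j hK hx
  | cons W b N ih =>
    have hw := (le_max_right _ _).trans hN
    -- The induction hypothesis needs the width of the tail to be at most its own input dimension.
    -- The bound `hw` gives this when the first layer is square, the only case in which it is used.
    exact reluVec_affineLayer_le_frontier hn (N.le_width.trans hw) W b
      (fun z => N.affineOutput z j) (fun h => ih (h ▸ hn) (hw.trans_eq h.symm) j) hK hx

/-- Since `max 0` is monotone, this transfers the maximum principle from affine to ReLU output. -/
theorem reluOutput_eq_max {n m : ℕ} (N : DNN n m) (x : Fin n → ℝ) (j : Fin m) :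
    N.reluOutput x j = max 0 (N.affineOutput x j) := by
  induction N with
  | last W b => rfl
  | cons W b N ih => exact ih _ j

/-- Maximum principle for networks whose width is at most the input dimension, with ReLU output. -/
theorem reluOutput_le_frontier {n m : ℕ} (N : DNN n m) (hn : 1 ≤ n) (hN : N.width ≤ n)
    (j : Fin m) (K : Set (Fin n → ℝ)) (hK : IsCompact K) (x : Fin n → ℝ) (hx : x ∈ K) :
    ∃ y ∈ frontier K, N.reluOutput x j ≤ N.reluOutput y j := by
  obtain ⟨y, hy, hxy⟩ := N.affineOutput_le_frontier hn hN j K hK x hx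
  exact ⟨y, hy, by simpa only [reluOutput_eq_max] using max_le_max_left 0 hxy⟩

end DNN

/-- A function that satisfies the maximum principle on compact sets is not uniformly close to
`2 * δ * (1 - ‖x‖)` on the unit ball. -/
theorem exists_le_norm_sub_of_le_frontier {n : ℕ} {δ : ℝ} (g : (Fin n → ℝ) → ℝ)
    (hg : ∀ K : Set (Fin n → ℝ), IsCompact K → ∀ x ∈ K, ∃ y ∈ frontier K, g x ≤ g y) :
    ∃ x : Metric.closedBall (0 : EuclideanSpace ℝ (Fin n)) 1,
      δ ≤ ‖g x.1.ofLp - 2 * δ * (1 - ‖x.1‖)‖ := by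
  let e := (EuclideanSpace.equiv (Fin n) ℝ).toHomeomorph
  obtain ⟨_, hy, hle⟩ := hg (e '' Metric.closedBall 0 1)
    ((isCompact_closedBall _ _).image e.continuous) (e 0)
    (Set.mem_image_of_mem _ (Metric.mem_closedBall_self zero_le_one))
  rw [← e.image_frontier] at hy
  obtain ⟨y, hy, rfl⟩ := hy
  have hy1 : ‖y‖ = 1 := by
    simpa using Metric.frontier_closedBall_subset_sphere hy
  by_contra! hcon
  -- Closeness would force `g > δ` at the centre and `g < δ` at the boundary point `y`, against
  -- `hle`.
  have h0 := (abs_lt.1 (hcon ⟨0, Metric.mem_closedBall_self zero_le_one⟩)).1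
  have h1 := (abs_lt.1 (hcon ⟨y, by simp [hy1]⟩)).2
  replace hle : g (WithLp.ofLp (0 : EuclideanSpace ℝ (Fin n))) ≤ g y.ofLp := hle
  simp only [norm_zero, hy1] at h0 h1
  linarith

theorem corollary5p1 (n : ℕ) (hn : 1 ≤ n) (δ : ℝ) (hδ : 0 < δ) :
    ∃ f : C(Metric.closedBall (0 : EuclideanSpace ℝ (Fin n)) 1, ℝ),
      ∀ N : DNN n 1, N.width ≤ n →
        (∃ x : Metric.closedBall (0 : EuclideanSpace ℝ (Fin n)) 1,
          δ ≤ ‖N.reluOutput x.1.ofLp 0 - f x‖) ∧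
        (∃ x : Metric.closedBall (0 : EuclideanSpace ℝ (Fin n)) 1,
          δ ≤ ‖N.affineOutput x.1.ofLp 0 - f x‖) := by
  refine ⟨⟨fun x => 2 * δ * (1 - ‖x.1‖), by fun_prop⟩, fun N hN => ⟨?_, ?_⟩⟩
  · exact exists_le_norm_sub_of_le_frontier (fun x => N.reluOutput x 0)
      (N.reluOutput_le_frontier hn hN 0)
  · exact exists_le_norm_sub_of_le_frontier (fun x => N.affineOutput x 0)
      (N.affineOutput_le_frontier hn hN 0)
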